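/- Let $\mathcal{A}$ be a skeletally small abelian length category (every object has a finite filtration starting at $0$ with simple successive quotients), and let $n\geq 1$. All subcategories are full and closed under isomorphism. A subcategory $\mathscr{M}\subseteq\mathcal{A}$ is $n$-cluster-tilting if it is functorially finite (every object of $\mathcal{A}$ has a right and a left $\mathscr{M}$-approximation), every object of $\mathcal{A}$ is a quotient of an object of $\mathscr{M}$ and a subobject of an object of $\mathscr{M}$, and $$\mathscr{M}=\{X : \operatorname{Ext}^i_{\mathcal{A}}(X,M)=0\ \forall M\in\mathscr{M},\ 1\le i\le n-1\}=\{Y : \operatorname{Ext}^i_{\mathcal{A}}(M,Y)=0\ \forall M\in\mathscr{M},\ 1\le i\le n-1\}.$$ A torsion pair is a pair $(\mathcal{T},\mathcal{F})$ of subcategories of $\mathcal{A}$ with $\operatorname{Hom}(X,Y)=0$ for $X\in\mathcal{T}$, $Y\in\mathcal{F}$, such that every $M\in\mathcal{A}$ has a short exact sequence $0\to tM\to M\to fM\to 0$ with $tM\in\mathcal{T}$ and $fM\in\mathcal{F}$ (this sequence is unique up to isomorphism); then $\mathcal{T}$ is called a torsion class. For a subcategory $\mathcal{X}$, $T(\mathcal{X})$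 denotes the smallest torsion class of $\mathcal{A}$ containing $\mathcal{X}$. A complex $X^0\to X^1\to\cdots\to X^{n+1}$ in $\mathscr{M}$ is $n$-exact if for all $N\in\mathscr{M}$ the sequences $0\to\operatorname{Hom}(N,X^0)\to\cdots\to\operatorname{Hom}(N,X^{n+1})$ and $0\to\operatorname{Hom}(X^{n+1},N)\to\cdots\to\operatorname{Hom}(X^0,N)$ are exact. A subcategory $\mathscr{U}\subseteq\mathscr{M}$ is an $n$-torsion class of $\mathscr{M}$ if every $M\in\mathscr{M}$ admits an $n$-exact sequence $U^M\to M\to V^1\to\cdots\to V^n$ in $\mathscr{M}$ with $U^M\in\mathscr{U}$ such that $0\to\operatorname{Hom}(U,V^1)\to\cdots\to\operatorname{Hom}(U,V^n)\to 0$ is exact for all $U\in\mathscr{U}$. **Theorem.** Let $\mathscr{M}$ be an $n$-cluster-tilting subcategory of $\mathcal{A}$. Then $\mathscr{U}\mapsto T(\mathscr{U})$ is a well-defined injective morphism of posets (ordered by inclusion) from the $n$-torsion classes of $\mathscr{M}$ to the torsion classes of $\mathcal{A}$. Moreover, let $\mathcal{T}$ be a torsion class of $\mathcal{A}$, with torsion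 pair $(\mathcal{T},\mathcal{F})$, and let $t\mathscr{M}$ and $f\mathscr{M}$ be the classes of objects isomorphic to $tM$, respectively to $fM=\operatorname{coker}(tM\to M)$, for some $M\in\mathscr{M}$. Then $\mathcal{T}=T(\mathscr{U})$ for some $n$-torsion class $\mathscr{U}$ of $\mathscr{M}$ if and only if 1. $t\mathscr{M}\subseteq\mathscr{M}$; 2. $\mathcal{T}=T(t\mathscr{M})$; 3. $\operatorname{Ext}^{n-1}_{\mathcal{A}}(X,Y)=0$ for all $X\in t\mathscr{M}$ and $Y\in f\mathscr{M}$ (where $\operatorname{Ext}^0=\operatorname{Hom}$). In this case, for every such $\mathscr{U}$, one has $\mathscr{U}=\mathcal{T}\cap\mathscr{M}=t\mathscr{M}$. -/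

import Mathlib

open CategoryTheory CategoryTheory.Limits CategoryTheory.Abelian

universe w v u

namespace NTors

variable {A : Type u} [Category.{v} A] [Abelian A]

/-- Objects with a finite filtration `0 = X₀ ⊆ X₁ ⊆ ⋯ ⊆ Xₘ = X` all of whose successive quotients
are simple. -/
inductive HasFiniteLength : A → Prop
  | zero (X : A) (hX : IsZero X) : HasFiniteLength X
  | step (S : ShortComplex A) (hS : S.ShortExact) (h₁ : HasFiniteLength S.X₁)
      (h₃ : Simple S.X₃) : HasFiniteLength S.X₂

variable (A) in
/-- A length category: every object has finite length. -/
def IsLengthCategory : Prop := ∀ X : A, HasFiniteLength X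

/-- `Fac 𝓧 = A`: every object is a quotient of an object of `𝓧`. -/
def IsGeneratingSubcategory (𝓧 : ObjectProperty A) : Prop :=
  ∀ Y : A, ∃ (X : A) (p : X ⟶ Y), 𝓧 X ∧ Epi p

/-- `Sub 𝓧 = A`: every object is a subobject of an object of `𝓧`. -/
def IsCogeneratingSubcategory (𝓧 : ObjectProperty A) : Prop :=
  ∀ Y : A, ∃ (X : A) (j : Y ⟶ X), 𝓧 X ∧ Mono j

/-- Every object has a right `𝓧`-approximation. -/
def IsContravariantlyFinite (𝓧 : ObjectProperty A) : Prop :=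
  ∀ Y : A, ∃ (X : A) (p : X ⟶ Y), 𝓧 X ∧
    ∀ (X' : A) (p' : X' ⟶ Y), 𝓧 X' → ∃ g : X' ⟶ X, g ≫ p = p'

/-- Every object has a left `𝓧`-approximation. -/
def IsCovariantlyFinite (𝓧 : ObjectProperty A) : Prop :=
  ∀ Y : A, ∃ (X : A) (j : Y ⟶ X), 𝓧 X ∧
    ∀ (X' : A) (j' : Y ⟶ X'), 𝓧 X' → ∃ g : X ⟶ X', j ≫ g = j'

/-- `n`-cluster-tilting subcategories of an abelian category. -/
structure IsNClusterTilting [HasExt.{w} A] (n : ℕ) (𝓜 : ObjectProperty A) : Prop where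
  contravariantlyFinite : IsContravariantlyFinite 𝓜
  covariantlyFinite : IsCovariantlyFinite 𝓜
  generating : IsGeneratingSubcategory 𝓜
  cogenerating : IsCogeneratingSubcategory 𝓜
  mem_iff_ext_left : ∀ X : A, 𝓜 X ↔
    ∀ M : A, 𝓜 M → ∀ i : ℕ, 1 ≤ i → i ≤ n - 1 → Subsingleton (Ext.{w} X M i)
  mem_iff_ext_right : ∀ Y : A, 𝓜 Y ↔
    ∀ M : A, 𝓜 M → ∀ i : ℕ, 1 ≤ i → i ≤ n - 1 → Subsingleton (Ext.{w} M Y i)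

/-- A torsion pair `(𝒯, 𝓕)` of (full, isomorphism-closed) subcategories. -/
structure IsTorsionPair (𝒯 𝓕 : ObjectProperty A) : Prop where
  closedUnderIso_left : 𝒯.IsClosedUnderIsomorphisms
  closedUnderIso_right : 𝓕.IsClosedUnderIsomorphisms
  hom_eq_zero : ∀ (X Y : A), 𝒯 X → 𝓕 Y → ∀ f : X ⟶ Y, f = 0
  exists_shortExact : ∀ M : A, ∃ S : ShortComplex A,
    S.ShortExact ∧ 𝒯 S.X₁ ∧ Nonempty (S.X₂ ≅ M) ∧ 𝓕 S.X₃

/-- A torsion class: the left half of a torsion pair. -/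
def IsTorsionClass (𝒯 : ObjectProperty A) : Prop :=
  ∃ 𝓕 : ObjectProperty A, IsTorsionPair 𝒯 𝓕

/-- `T(𝓧)`, the smallest torsion class containing `𝓧`, given as the intersection of all torsion
classes containing `𝓧`. -/
def minTorsionClass (𝓧 : ObjectProperty A) : ObjectProperty A :=
  fun X ↦ ∀ 𝒮 : ObjectProperty A, IsTorsionClass 𝒮 → 𝓧 ≤ 𝒮 → 𝒮 X

/-- `t𝓜`: the objects isomorphic to `tM` for some `M` in `𝓜`, where `0 ⟶ tM ⟶ M ⟶ fM ⟶ 0` is the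
canonical short exact sequence of `M` for the torsion pair `(𝒯, 𝓕)`. -/
def torsionParts (𝒯 𝓕 𝓜 : ObjectProperty A) : ObjectProperty A :=
  fun X ↦ ∃ S : ShortComplex A, S.ShortExact ∧ 𝒯 S.X₁ ∧ 𝓜 S.X₂ ∧ 𝓕 S.X₃ ∧ Nonempty (X ≅ S.X₁)

/-- `f𝓜`: the objects isomorphic to `fM = coker (tM ⟶ M)` for some `M` in `𝓜`. -/
def torsionFreeParts (𝒯 𝓕 𝓜 : ObjectProperty A) : ObjectProperty A :=
  fun Y ↦ ∃ S : ShortComplex A, S.ShortExact ∧ 𝒯 S.X₁ ∧ 𝓜 S.X₂ ∧ 𝓕 S.X₃ ∧ Nonempty (Y ≅ S.X₃)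

/-- The complex `X⁰ ⟶ X¹ ⟶ ⋯ ⟶ Xⁿ⁺¹` (with zeros beyond) is an `n`-exact sequence in the full
subcategory `𝓜`. -/
structure IsNExact (n : ℕ) (𝓜 : ObjectProperty A) (K : CochainComplex A ℕ) : Prop where
  mem : ∀ i, i ≤ n + 1 → 𝓜 (K.X i)
  isZero : ∀ i, n + 1 < i → IsZero (K.X i)
  /-- For `N` in `𝓜`, exactness of `0 ⟶ (N, X⁰) ⟶ ⋯ ⟶ (N, Xⁿ) ⟶ (N, Xⁿ⁺¹)` at `(N, X⁰)`. -/
  kernel_zero : ∀ N : A, 𝓜 N → ∀ f : N ⟶ K.X 0, f ≫ K.d 0 1 = 0 → f = 0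
  /-- Exactness of the same sequence at `(N, Xⁱ⁺¹)`, for `1 ≤ i + 1 ≤ n`. -/
  kernel_succ : ∀ N : A, 𝓜 N → ∀ i, i < n → ∀ f : N ⟶ K.X (i + 1),
    f ≫ K.d (i + 1) (i + 2) = 0 → ∃ g : N ⟶ K.X i, g ≫ K.d i (i + 1) = f
  /-- For `N` in `𝓜`, exactness of `0 ⟶ (Xⁿ⁺¹, N) ⟶ (Xⁿ, N) ⟶ ⋯ ⟶ (X⁰, N)` at `(Xⁿ⁺¹, N)`. -/
  cokernel_last : ∀ N : A, 𝓜 N → ∀ f : K.X (n + 1) ⟶ N, K.d n (n + 1) ≫ f = 0 → f = 0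
  /-- Exactness of the same sequence at `(Xⁱ⁺¹, N)`, for `1 ≤ i + 1 ≤ n`. -/
  cokernel_succ : ∀ N : A, 𝓜 N → ∀ i, i < n → ∀ f : K.X (i + 1) ⟶ N,
    K.d i (i + 1) ≫ f = 0 → ∃ g : K.X (i + 2) ⟶ N, K.d (i + 1) (i + 2) ≫ g = f

/-- An `n`-torsion class `𝓤` of `𝓜` (`n ≥ 1`): a full, isomorphism-closed subcategory of `𝓜` such
that every `M` in `𝓜` has an `n`-exact sequence
`0 ⟶ U ⟶ M ⟶ V¹ ⟶ ⋯ ⟶ Vⁿ ⟶ 0` in `𝓜` with `U` in `𝓤` for which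
`0 ⟶ (U', V¹) ⟶ ⋯ ⟶ (U', Vⁿ) ⟶ 0` is exact for all `U'` in `𝓤`.
In the complex `K` below, `U = K⁰`, `M ≅ K¹`, `Vⁱ = Kⁱ⁺¹` and `Kⁱ = 0` for `i > n + 1`. -/
structure IsNTorsionClass (n : ℕ) (𝓜 𝓤 : ObjectProperty A) : Prop where
  closedUnderIso : 𝓤.IsClosedUnderIsomorphisms
  le : 𝓤 ≤ 𝓜
  exists_nExact : ∀ M : A, 𝓜 M → ∃ K : CochainComplex A ℕ,
    IsNExact n 𝓜 K ∧ 𝓤 (K.X 0) ∧ Nonempty (K.X 1 ≅ M) ∧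
    ∀ U' : A, 𝓤 U' →
      (∀ f : U' ⟶ K.X 2, f ≫ K.d 2 3 = 0 → f = 0) ∧
      (∀ i, 2 ≤ i → i ≤ n → ∀ f : U' ⟶ K.X (i + 1), f ≫ K.d (i + 1) (i + 2) = 0 →
        ∃ g : U' ⟶ K.X i, g ≫ K.d i (i + 1) = f)

end NTors

/-!
Write `𝓧^⊥` for the right and `^⊥𝓨` for the left orthogonal with respect to `Hom`.

In a length category `(^⊥(𝓧^⊥), 𝓧^⊥)` is a torsion pair for every `𝓧`, whence `T(𝓧) = ^⊥(𝓧^⊥)`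
(`minTorsionClass_eq`). The decomposition of an object comes from an epimorphic reflection into
`𝓧^⊥`, which exists by induction on the length (`HasFiniteLength.hasEpiReflection`).

Let `𝓤` be an `n`-torsion class of `𝓜`. Since `𝓜` is generating and cogenerating, the `n`-exact
sequence `0 ⟶ U ⟶ M ⟶ V¹ ⟶ ⋯ ⟶ Vⁿ ⟶ 0` is exact in `A`, and the conditions on `Hom(U', V•)` say that
`C = coker (U ⟶ M)` lies in `𝓤^⊥` and, after shifting dimensions along the `Vⁱ`, that
`Ext^{n-1}(U', C) = 0` (`IsNTorsionClass.exists_shortExact`). Hence `0 ⟶ U ⟶ M ⟶ C ⟶ 0` is the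
canonical sequence of `M` for the torsion pair generated by `𝓤`, so that `t𝓜 = 𝓤`
(`IsNTorsionClass.torsionParts_eq`). Injectivity, the equalities `𝓤 = T(𝓤) ∩ 𝓜 = t𝓜` and the
necessity of the three conditions follow.

Conversely, when the three conditions hold, put `𝓤 = t𝓜`. Iterated left `𝓜`-approximations give a
coresolution `0 ⟶ fM ⟶ V¹ ⟶ ⋯ ⟶ Vⁿ ⟶ 0` in `𝓜` (`IsNClusterTilting.exists_coresolution`), which is
spliced with `0 ⟶ tM ⟶ M ⟶ fM ⟶ 0`. Lifting a morphism along one of the differentials is obstructed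
by an `Ext¹` into a syzygy, which dimension shifting embeds into some `Ext^i(𝓜, tM)` with
`1 ≤ i ≤ n - 1`, or, for morphisms out of `𝓤`, into some `Ext^j(𝓤, fM)` with `1 ≤ j ≤ n - 1`; the
latter vanishes for `j < n - 1` because `tM` and `M` lie in `𝓜`, and for `j = n - 1` by the third
condition (`IsNClusterTilting.exists_nExact`).
-/

namespace NTors

/-! ### Torsion pairs generated by a class of objects in a length category -/

section Torsion

variable {A : Type u} [Category.{v} A] [Abelian A]

lemma _root_.CategoryTheory.ShortComplex.ShortExact.isIso_f_of_g_eq_zero {S : ShortComplex A}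
    (hS : S.ShortExact) (hg : S.g = 0) : IsIso S.f :=
  have := hS.mono_f
  have := (ShortComplex.exact_iff_epi S hg).1 hS.exact
  isIso_of_mono_of_epi S.f

lemma rightOrthogonal_of_shortExact {𝓧 : ObjectProperty A} {S : ShortComplex A} (hS : S.ShortExact)
    (h₁ : 𝓧.rightOrthogonal S.X₁) (h₃ : 𝓧.rightOrthogonal S.X₃) : 𝓧.rightOrthogonal S.X₂ := by
  intro X f hX
  have := hS.mono_f
  obtain ⟨l, rfl⟩ := hS.exact.lift' f (h₃ _ hX)
  rw [h₁ l hX, zero_comp]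

/-- `N` has an epimorphic reflection `q : N ⟶ Z` into the right orthogonal of `𝓧`. -/
def HasEpiReflection (𝓧 : ObjectProperty A) (N : A) : Prop :=
  ∃ (Z : A) (q : N ⟶ Z), Epi q ∧ 𝓧.rightOrthogonal Z ∧
    ∀ (Y : A) (f : N ⟶ Y), 𝓧.rightOrthogonal Y → ∃ g : Z ⟶ Y, q ≫ g = f

/-- It suffices to find a reflection of a quotient `Q` through which all morphisms from `N` to the
right orthogonal factor. -/
lemma HasEpiReflection.of_epi {𝓧 : ObjectProperty A} {N Q : A} (h : HasEpiReflection 𝓧 Q)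
    (p : N ⟶ Q) [Epi p]
    (hp : ∀ (Y : A) (f : N ⟶ Y), 𝓧.rightOrthogonal Y → ∃ g : Q ⟶ Y, p ≫ g = f) :
    HasEpiReflection 𝓧 N := by
  obtain ⟨Z, q, _, hZ, hq⟩ := h
  refine ⟨Z, p ≫ q, inferInstance, hZ, fun Y f hY ↦ ?_⟩
  obtain ⟨g, rfl⟩ := hp Y f hY
  obtain ⟨g', rfl⟩ := hq Y g hY
  exact ⟨g', by simp⟩

lemma eq_zero_or_epi_of_epi_from_simple {S C W : A} [Simple S] (q : S ⟶ C) [Epi q] (h : W ⟶ C) :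
    h = 0 ∨ Epi h := by
  by_cases hq : q = 0
  · left
    have : 𝟙 C = 0 := by rw [← cancel_epi q]; simp [hq]
    rw [← Category.comp_id h, this, comp_zero]
  · have := isIso_of_epi_of_nonzero hq
    have : Simple C := Simple.of_iso (asIso q).symm
    by_cases hh : h = 0
    · exact Or.inl hh
    · exact Or.inr (epi_of_nonzero_to_simple hh)

/-- The inductive step for the existence of reflections. The quotient `N` of `S.X₂` is replaced by
its pushout `N'` along the reflection of the image of `S.X₁`. A nonzero morphism `X ⟶ N'` from `𝓧`
then surjects onto the remaining factor, a quotient of the simple object `S.X₃`, so that its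
cokernel is a quotient of `S.X₁`. -/
lemma hasEpiReflection_step (𝓧 : ObjectProperty A) {S : ShortComplex A} (hS : S.ShortExact)
    [Simple S.X₃]
    (h₁ : ∀ (N : A) (p : S.X₁ ⟶ N), Epi p → HasEpiReflection 𝓧 N)
    (N : A) (p : S.X₂ ⟶ N) [Epi p] : HasEpiReflection 𝓧 N := by
  have := hS.epi_g
  obtain ⟨J, a, j, _, _, haj⟩ : ∃ (J : A) (a : S.X₁ ⟶ J) (j : J ⟶ N), Epi a ∧ Mono j ∧
      a ≫ j = S.f ≫ p :=
    ⟨_, factorThruImage (S.f ≫ p), image.ι _, inferInstance, inferInstance, image.fac _⟩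
  obtain ⟨Z, q, _, hZ, hq⟩ := h₁ _ a inferInstance
  let m : Z ⟶ pushout q j := pushout.inl q j
  let r : N ⟶ pushout q j := pushout.inr q j
  have hmr : q ≫ m = j ≫ r := pushout.condition
  refine HasEpiReflection.of_epi ?_ r (fun Y f hY ↦ ?_)
  swap
  · obtain ⟨g, hg⟩ := hq Y (j ≫ f) hY
    exact ⟨pushout.desc g f hg, pushout.inr_desc _ _ _⟩
  by_cases hN' : 𝓧.rightOrthogonal (pushout q j)
  · exact ⟨_, 𝟙 _, inferInstance, hN', fun Y f _ ↦ ⟨f, by simp⟩⟩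
  obtain ⟨X, h, hX, h0⟩ : ∃ (X : A) (h : X ⟶ pushout q j), 𝓧 X ∧ h ≠ 0 := by
    simpa [ObjectProperty.rightOrthogonal_iff] using hN'
  -- `c` is the projection to the part of `N'` not seen by `S.X₁`.
  let c := cokernel.π m
  obtain ⟨s, hs⟩ : ∃ s, S.g ≫ s = p ≫ r ≫ c :=
    hS.exact.desc' (p ≫ r ≫ c) (by
      rw [← reassoc_of% haj, ← reassoc_of% hmr, cokernel.condition]
      simp)
  have : Epi (S.g ≫ s) := by rw [hs]; infer_instance
  have : Epi s := epi_of_epi S.g s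
  -- If `h ≫ c = 0`, then `h` factors through `Z`, which receives no morphism from `X`.
  have hc : Epi (h ≫ c) := by
    refine (eq_zero_or_epi_of_epi_from_simple s (h ≫ c)).resolve_left (fun hc ↦ h0 ?_)
    have hmc : (ShortComplex.mk m c (cokernel.condition m)).Exact :=
      ShortComplex.exact_of_g_is_cokernel _ (cokernelIsCokernel m)
    have : Mono (ShortComplex.mk m c (cokernel.condition m)).f := inferInstanceAs (Mono m)
    obtain ⟨l, rfl⟩ := hmc.lift' h hc
    simp [hZ l hX]
  -- A morphism from `coker h` killed by `S.X₁` is induced by one from `coker m`, which vanishes since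
  -- its composite with the epimorphism `h ≫ c` is zero.
  refine HasEpiReflection.of_epi (h₁ _ (S.f ≫ p ≫ r ≫ cokernel.π h) ?_) (cokernel.π h)
    (fun Y f hY ↦ ⟨cokernel.desc h f (hY _ hX), by simp⟩)
  refine Preadditive.epi_of_cancel_zero _ (fun {W} z hz ↦ ?_)
  have hz' : m ≫ cokernel.π h ≫ z = 0 := by
    rw [← cancel_epi q, ← cancel_epi a, reassoc_of% hmr, reassoc_of% haj]
    simpa using hz
  obtain ⟨z', hz''⟩ : ∃ z', c ≫ z' = cokernel.π h ≫ z :=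
    ⟨cokernel.desc m _ hz', by simp [c]⟩
  have : z' = 0 := by
    rw [← cancel_epi (h ≫ c), Category.assoc, hz'']
    simp
  rw [← cancel_epi (cokernel.π h), ← hz'', this]
  simp

/-- The induction is on the filtration, with all quotients of an object treated at once. -/
lemma HasFiniteLength.hasEpiReflection (𝓧 : ObjectProperty A) {M : A} (hM : HasFiniteLength M) :
    ∀ (N : A) (p : M ⟶ N), Epi p → HasEpiReflection 𝓧 N := by
  induction hM with
  | zero X hX =>
    intro N p _
    have hN : IsZero N := hX.of_epi p
    exact ⟨N, 𝟙 N, inferInstance, fun _ _ _ ↦ hN.eq_of_tgt _ _, fun Y f _ ↦ ⟨f, by simp⟩⟩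
  | step S hS _ h₃ ih =>
    intro N p _
    exact hasEpiReflection_step 𝓧 hS ih N p

/-- The kernel of a reflection lies in the left orthogonal: the pushout of the sequence along a
morphism `S.X₁ ⟶ Y` lies in the right orthogonal, so the morphism from `S.X₂` to it factors through
`S.g` and vanishes on `S.X₁`. -/
lemma leftOrthogonal_kernel {𝓧 : ObjectProperty A} {S : ShortComplex A} (hS : S.ShortExact)
    (h₃ : 𝓧.rightOrthogonal S.X₃)
    (hS' : ∀ (Y : A) (f : S.X₂ ⟶ Y), 𝓧.rightOrthogonal Y → ∃ g : S.X₃ ⟶ Y, S.g ≫ g = f) :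
    𝓧.rightOrthogonal.leftOrthogonal S.X₁ := by
  intro Y f hY
  have := hS.mono_f
  have := hS.epi_g
  let i : Y ⟶ pushout S.f f := pushout.inr S.f f
  let r : S.X₂ ⟶ pushout S.f f := pushout.inl S.f f
  have hir : S.f ≫ r = f ≫ i := pushout.condition
  let b : pushout S.f f ⟶ S.X₃ := pushout.desc S.g 0 (by simp)
  have hrb : r ≫ b = S.g := pushout.inl_desc _ _ _
  have hib : i ≫ b = 0 := pushout.inr_desc _ _ _
  have : Epi (r ≫ b) := by rw [hrb]; infer_instance
  -- The pushout is an extension of `S.X₃` by `Y`.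
  have hSE : (ShortComplex.mk i b hib).ShortExact := by
    obtain ⟨s, hs⟩ : ∃ s, S.g ≫ s = r ≫ cokernel.π i :=
      hS.exact.desc' _ (by rw [reassoc_of% hir, cokernel.condition, comp_zero])
    have hbs : b ≫ s = cokernel.π i := by
      refine pushout.hom_ext ?_ ?_
      · change r ≫ _ = r ≫ _
        rw [reassoc_of% hrb, hs]
      · change i ≫ _ = i ≫ _
        rw [reassoc_of% hib, zero_comp, cokernel.condition]
    have : Epi b := epi_of_epi r b
    exact .mk' (ShortComplex.exact_of_g_is_cokernel _
      (CokernelCofork.IsColimit.ofπ' b hib (fun k hk ↦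
        ⟨s ≫ cokernel.desc i k hk, by rw [reassoc_of% hbs, cokernel.π_desc]⟩)))
      (inferInstanceAs (Mono i)) this
  obtain ⟨g, hg⟩ := hS' _ r (rightOrthogonal_of_shortExact hSE hY h₃)
  rw [← cancel_mono i, ← hir, ← hg]
  simp

theorem isTorsionPair_leftOrthogonal_rightOrthogonal (hA : IsLengthCategory A)
    (𝓧 : ObjectProperty A) :
    IsTorsionPair 𝓧.rightOrthogonal.leftOrthogonal 𝓧.rightOrthogonal where
  closedUnderIso_left := inferInstance
  closedUnderIso_right := inferInstance
  hom_eq_zero _ _ hX hY f := hX f hY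
  exists_shortExact M := by
    obtain ⟨Z, q, _, hZ, hq⟩ := (hA M).hasEpiReflection 𝓧 M (𝟙 M) inferInstance
    have hS : (ShortComplex.mk (kernel.ι q) q (kernel.condition q)).ShortExact :=
      .mk' (ShortComplex.exact_of_f_is_kernel _ (kernelIsKernel q))
        (inferInstanceAs (Mono (kernel.ι q))) ‹_›
    exact ⟨_, hS, leftOrthogonal_kernel hS hZ hq, ⟨Iso.refl _⟩, hZ⟩

/-- A torsion class containing `𝓧` has its torsion-free class inside `𝓧^⊥`. -/
lemma IsTorsionPair.leftOrthogonal_le {𝒯 𝓕 𝓧 : ObjectProperty A} (h : IsTorsionPair 𝒯 𝓕)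
    (hX : 𝓧 ≤ 𝒯) : 𝓧.rightOrthogonal.leftOrthogonal ≤ 𝒯 := by
  intro M hM
  obtain ⟨S, hS, h₁, ⟨e⟩, h₃⟩ := h.exists_shortExact M
  have := h.closedUnderIso_left
  have hg : S.g = 0 := by
    rw [← cancel_epi e.inv, comp_zero]
    exact hM _ (fun X f hf ↦ h.hom_eq_zero X _ (hX _ hf) h₃ f)
  have := hS.isIso_f_of_g_eq_zero hg
  exact 𝒯.prop_of_iso (asIso S.f ≪≫ e) h₁

theorem minTorsionClass_eq (hA : IsLengthCategory A) (𝓧 : ObjectProperty A) :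
    minTorsionClass 𝓧 = 𝓧.rightOrthogonal.leftOrthogonal := by
  refine le_antisymm (fun X hX ↦ hX _ ⟨_, isTorsionPair_leftOrthogonal_rightOrthogonal hA 𝓧⟩
    (fun _ hX _ f hY ↦ hY f hX)) ?_
  rintro X hX 𝒮 ⟨𝓖, h⟩ hS
  exact h.leftOrthogonal_le hS X hX

lemma le_minTorsionClass (𝓧 : ObjectProperty A) : 𝓧 ≤ minTorsionClass 𝓧 :=
  fun _ hX _ _ h ↦ h _ hX

lemma minTorsionClass_mono {𝓧 𝓨 : ObjectProperty A} (h : 𝓧 ≤ 𝓨) :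
    minTorsionClass 𝓧 ≤ minTorsionClass 𝓨 :=
  fun _ hX 𝒮 hS hY ↦ hX 𝒮 hS (h.trans hY)

/-- Uniqueness of the canonical sequence: an isomorphism between the middle terms of two short exact
sequences induces isomorphisms of the outer terms as soon as the cross terms have no morphisms. -/
lemma exists_iso_of_shortExact {S S' : ShortComplex A} (hS : S.ShortExact) (hS' : S'.ShortExact)
    (e : S.X₂ ≅ S'.X₂) (h : ∀ f : S.X₁ ⟶ S'.X₃, f = 0) (h' : ∀ f : S'.X₁ ⟶ S.X₃, f = 0) :
    Nonempty (S.X₁ ≅ S'.X₁) ∧ Nonempty (S.X₃ ≅ S'.X₃) := by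
  have := hS.mono_f
  have := hS.epi_g
  have := hS'.mono_f
  have := hS'.epi_g
  obtain ⟨a, ha⟩ := hS'.exact.lift' (S.f ≫ e.hom) (h _)
  obtain ⟨a', ha'⟩ := hS.exact.lift' (S'.f ≫ e.inv) (h' _)
  obtain ⟨b, hb⟩ := hS.exact.desc' (e.hom ≫ S'.g) (h _)
  obtain ⟨b', hb'⟩ := hS'.exact.desc' (e.inv ≫ S.g) (h' _)
  exact ⟨⟨a, a', by simp [← cancel_mono S.f, ha', reassoc_of% ha],
      by simp [← cancel_mono S'.f, ha, reassoc_of% ha']⟩,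
    ⟨b, b', by simp [← cancel_epi S.g, hb', reassoc_of% hb],
      by simp [← cancel_epi S'.g, hb, reassoc_of% hb']⟩⟩

end Torsion

/-! ### Vanishing of `Ext` in short exact sequences -/

section ExtVanishing

variable {A : Type u} [Category.{v} A] [Abelian A] [HasExt.{w} A] {S : ShortComplex A}

lemma ext_subsingleton_X₁ (hS : S.ShortExact) {X : A} {j : ℕ}
    (h₂ : Subsingleton (Ext.{w} X S.X₂ (j + 1))) (h₃ : Subsingleton (Ext.{w} X S.X₃ j)) :
    Subsingleton (Ext.{w} X S.X₁ (j + 1)) :=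
  subsingleton_of_forall_eq 0 fun x ↦ by
    obtain ⟨y, rfl⟩ := Ext.covariant_sequence_exact₁ X hS x (Subsingleton.elim _ _) rfl
    rw [Subsingleton.elim y 0, Ext.zero_comp]

lemma ext_one_subsingleton_X₁ (hS : S.ShortExact) {X : A}
    (h₂ : Subsingleton (Ext.{w} X S.X₂ 1)) (h : ∀ f : X ⟶ S.X₃, ∃ g, g ≫ S.g = f) :
    Subsingleton (Ext.{w} X S.X₁ 1) :=
  subsingleton_of_forall_eq 0 fun x ↦ by
    obtain ⟨y, rfl⟩ := Ext.covariant_sequence_exact₁ X hS x (Subsingleton.elim _ _) (zero_add 1)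
    obtain ⟨f, rfl⟩ := (Ext.mk₀_bijective X S.X₃).2 y
    obtain ⟨g, rfl⟩ := h f
    rw [← Ext.mk₀_comp_mk₀, Ext.comp_assoc_of_second_deg_zero, hS.comp_extClass, Ext.comp_zero]

lemma ext_subsingleton_X₃ (hS : S.ShortExact) {X : A} {j : ℕ}
    (h₂ : Subsingleton (Ext.{w} X S.X₂ j)) (h₁ : Subsingleton (Ext.{w} X S.X₁ (j + 1))) :
    Subsingleton (Ext.{w} X S.X₃ j) :=
  subsingleton_of_forall_eq 0 fun x ↦ by
    obtain ⟨y, rfl⟩ := Ext.covariant_sequence_exact₃ X hS x rfl (Subsingleton.elim _ _)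
    rw [Subsingleton.elim y 0, Ext.zero_comp]

lemma exists_lift_of_ext_one (hS : S.ShortExact) {X : A}
    (h₁ : Subsingleton (Ext.{w} X S.X₁ 1)) (f : X ⟶ S.X₃) : ∃ g, g ≫ S.g = f := by
  obtain ⟨y, hy⟩ := Ext.covariant_sequence_exact₃ X hS (Ext.mk₀ f) (zero_add 1)
    (Subsingleton.elim _ _)
  obtain ⟨g, rfl⟩ := (Ext.mk₀_bijective X S.X₂).2 y
  exact ⟨g, (Ext.mk₀_bijective X S.X₃).1 (by rw [← hy, Ext.mk₀_comp_mk₀])⟩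

lemma ext_subsingleton_X₃' (hS : S.ShortExact) {N : A} {j : ℕ}
    (h₂ : Subsingleton (Ext.{w} S.X₂ N (j + 1))) (h₁ : Subsingleton (Ext.{w} S.X₁ N j)) :
    Subsingleton (Ext.{w} S.X₃ N (j + 1)) :=
  subsingleton_of_forall_eq 0 fun x ↦ by
    obtain ⟨y, rfl⟩ := Ext.contravariant_sequence_exact₃ hS N x (Subsingleton.elim _ _)
      (Nat.add_comm 1 j)
    rw [Subsingleton.elim y 0, Ext.comp_zero]

lemma ext_one_subsingleton_X₃' (hS : S.ShortExact) {N : A}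
    (h₂ : Subsingleton (Ext.{w} S.X₂ N 1)) (h : ∀ f : S.X₁ ⟶ N, ∃ g, S.f ≫ g = f) :
    Subsingleton (Ext.{w} S.X₃ N 1) :=
  subsingleton_of_forall_eq 0 fun x ↦ by
    obtain ⟨y, rfl⟩ := Ext.contravariant_sequence_exact₃ hS N x (Subsingleton.elim _ _)
      (add_zero 1)
    obtain ⟨f, rfl⟩ := (Ext.mk₀_bijective S.X₁ N).2 y
    obtain ⟨g, rfl⟩ := h f
    rw [← Ext.mk₀_comp_mk₀, hS.extClass_comp_assoc]

lemma ext_subsingleton_of_iso {X X' Y Y' : A} (e : X ≅ X') (e' : Y ≅ Y') {j : ℕ}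
    (h : Subsingleton (Ext.{w} X Y j)) : Subsingleton (Ext.{w} X' Y' j) :=
  subsingleton_of_forall_eq 0 fun x ↦ by
    have hx : (Ext.mk₀ e.hom).comp (x.comp (Ext.mk₀ e'.inv) (add_zero j)) (zero_add j) = 0 :=
      Subsingleton.elim _ _
    have := congrArg (fun z ↦ (Ext.mk₀ e.inv).comp (z.comp (Ext.mk₀ e'.hom) (add_zero j))
      (zero_add j)) hx
    simpa using this

lemma ext_subsingleton_of_isZero {X Y : A} (hY : IsZero Y) (j : ℕ) :
    Subsingleton (Ext.{w} X Y j) :=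
  subsingleton_of_forall_eq 0 fun x ↦ by
    rw [← Ext.comp_mk₀_id x, hY.eq_of_src (𝟙 Y) 0, Ext.mk₀_zero, Ext.comp_zero]

end ExtVanishing

/-! ### Cluster-tilting subcategories -/

section ClusterTilting

variable {A : Type u} [Category.{v} A] [Abelian A] [HasExt.{w} A] {n : ℕ} {𝓜 : ObjectProperty A}

namespace IsNClusterTilting

variable (hM : IsNClusterTilting.{w} n 𝓜)
include hM

lemma ext_subsingleton {X Y : A} (hX : 𝓜 X) (hY : 𝓜 Y) {i : ℕ} (h₁ : 1 ≤ i) (h₂ : i + 1 ≤ n) :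
    Subsingleton (Ext.{w} X Y i) :=
  (hM.mem_iff_ext_left X).1 hX Y hY i h₁ (by lia)

lemma isClosedUnderIsomorphisms : 𝓜.IsClosedUnderIsomorphisms where
  of_iso e hX := (hM.mem_iff_ext_left _).2 fun M h i h₁ h₂ ↦
    ext_subsingleton_of_iso e (Iso.refl M) ((hM.mem_iff_ext_left _).1 hX M h i h₁ h₂)

/-- Monic left approximations, chosen to be isomorphisms on objects of `𝓜` so that iterating them
terminates as soon as possible. -/
lemma exists_mono_approximation (Y : A) : ∃ (V : A) (j : Y ⟶ V), 𝓜 V ∧ Mono j ∧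
    (∀ N, 𝓜 N → ∀ f : Y ⟶ N, ∃ g, j ≫ g = f) ∧ (𝓜 Y → IsIso j) := by
  by_cases hY : 𝓜 Y
  · exact ⟨Y, 𝟙 Y, hY, inferInstance, fun N _ f ↦ ⟨f, by simp⟩, fun _ ↦ inferInstance⟩
  · obtain ⟨V, j, hV, hj⟩ := hM.covariantlyFinite Y
    obtain ⟨V', j', hV', _⟩ := hM.cogenerating Y
    obtain ⟨g, rfl⟩ := hj V' j' hV'
    exact ⟨V, j, hV, mono_of_mono j g, fun N hN f ↦ hj N f hN, fun h ↦ (hY h).elim⟩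

end IsNClusterTilting

end ClusterTilting

/-! ### Spliced exact sequences and coresolutions -/

section Splicing

lemma shortExact_cokernel {A : Type u} [Category.{v} A] [Abelian A] {X Y : A} {j : X ⟶ Y}
    (hj : Mono j) :
    (ShortComplex.mk j (cokernel.π j) (cokernel.condition j)).ShortExact :=
  .mk' (ShortComplex.exact_of_g_is_cokernel _ (cokernelIsCokernel j)) hj
    (inferInstanceAs (Epi (cokernel.π j)))

variable (A : Type u) [Category.{v} A] [Abelian A]

/-- A sequence of short exact sequences `0 ⟶ C k ⟶ V k ⟶ C (k + 1) ⟶ 0`, to be spliced to a complex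
`V 0 ⟶ V 1 ⟶ ⋯` that is exact in positive degrees. -/
structure Splicing where
  /-- the syzygies -/
  C : ℕ → A
  /-- the terms of the complex -/
  V : ℕ → A
  /-- the inclusions of the syzygies -/
  ι : ∀ k, C k ⟶ V k
  /-- the projections onto the next syzygies -/
  π : ∀ k, V k ⟶ C (k + 1)
  zero : ∀ k, ι k ≫ π k = 0
  shortExact : ∀ k, (ShortComplex.mk (ι k) (π k) (zero k)).ShortExact

attribute [simp] Splicing.zero

variable {A}

namespace Splicing

variable (σ : Splicing A)

instance (k : ℕ) : Mono (σ.ι k) := (σ.shortExact k).mono_f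

instance (k : ℕ) : Epi (σ.π k) := (σ.shortExact k).epi_g

/-- The complex `V 0 ⟶ V 1 ⟶ ⋯`, whose differentials factor through the syzygies. -/
noncomputable def complex : CochainComplex A ℕ :=
  CochainComplex.of σ.V (fun k ↦ σ.π k ≫ σ.ι (k + 1)) (fun k ↦ by
    rw [Category.assoc, ← Category.assoc (σ.ι (k + 1)), σ.zero]
    simp)

lemma complex_d (k : ℕ) : (σ.complex.d k (k + 1) : σ.V k ⟶ σ.V (k + 1)) = σ.π k ≫ σ.ι (k + 1) :=
  CochainComplex.of_d σ.V (fun k ↦ σ.π k ≫ σ.ι (k + 1)) k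

lemma comp_complex_d (k : ℕ) {N : A} (f : N ⟶ σ.V k) :
    (f ≫ σ.complex.d k (k + 1) : N ⟶ σ.V (k + 1)) = f ≫ σ.π k ≫ σ.ι (k + 1) :=
  congrArg (CategoryStruct.comp f) (σ.complex_d k)

lemma complex_d_comp (k : ℕ) {N : A} (f : σ.V (k + 1) ⟶ N) :
    (σ.complex.d k (k + 1) ≫ f : σ.V k ⟶ N) = σ.π k ≫ σ.ι (k + 1) ≫ f :=
  (congrArg (fun d ↦ CategoryStruct.comp d f) (σ.complex_d k)).trans (Category.assoc _ _ _)

/-- The splicing obtained by prepending a short exact sequence, whose last term is identified with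
the first syzygy by an isomorphism. -/
def cons (S : ShortComplex A) (hS : S.ShortExact) (e : S.X₃ ≅ σ.C 0) : Splicing A where
  C := fun | 0 => S.X₁ | k + 1 => σ.C k
  V := fun | 0 => S.X₂ | k + 1 => σ.V k
  ι := fun | 0 => S.f | k + 1 => σ.ι k
  π := fun | 0 => S.g ≫ e.hom | k + 1 => σ.π k
  zero := fun | 0 => by simp | k + 1 => σ.zero k
  shortExact := fun
    | 0 => ShortComplex.shortExact_of_iso
        (ShortComplex.isoMk (Iso.refl _) (Iso.refl _) e (by simp) (by simp) :
          S ≅ ShortComplex.mk S.f (S.g ≫ e.hom) (by simp)) hS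
    | k + 1 => σ.shortExact k

/-- Left exactness: cycles of the complex come from the syzygy. -/
lemma exists_lift (k : ℕ) {N : A} (f : N ⟶ σ.V k) (hf : f ≫ σ.π k ≫ σ.ι (k + 1) = 0) :
    ∃ g : N ⟶ σ.C k, g ≫ σ.ι k = f :=
  have := (σ.shortExact k).mono_f
  (σ.shortExact k).exact.lift' f
    (zero_of_comp_mono (σ.ι (k + 1)) ((Category.assoc _ _ _).trans hf))

lemma exists_desc (k : ℕ) {N : A} (f : σ.V k ⟶ N) (hf : σ.ι k ≫ f = 0) :
    ∃ g : σ.C (k + 1) ⟶ N, σ.π k ≫ g = f :=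
  have := (σ.shortExact k).epi_g
  (σ.shortExact k).exact.desc' f hf

lemma isZero_C_succ (k : ℕ) [IsIso (σ.ι k)] : IsZero (σ.C (k + 1)) := by
  have : σ.π k = 0 := by rw [← cancel_epi (σ.ι k), σ.zero, comp_zero]
  rw [IsZero.iff_id_eq_zero, ← cancel_epi (σ.π k), this, zero_comp, zero_comp]

variable [HasExt.{w} A]

/-- Dimension shifting along the syzygies, in the range `j + i ≤ m`: `Ext^j(N, C (i + 1))` embeds
into `Ext^{j+1}(N, C i)` when `Ext^j(N, V i) = 0`. -/
lemma ext_C_subsingleton {N : A} (a m : ℕ)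
    (hC : ∀ j, 1 ≤ j → j + a ≤ m → Subsingleton (Ext.{w} N (σ.C a) j))
    (hV : ∀ i, a ≤ i → ∀ j, 1 ≤ j → j + i + 1 ≤ m → Subsingleton (Ext.{w} N (σ.V i) j)) :
    ∀ i, a ≤ i → ∀ j, 1 ≤ j → j + i ≤ m → Subsingleton (Ext.{w} N (σ.C i) j) := by
  intro i hi
  induction i, hi using Nat.le_induction with
  | base => exact hC
  | succ i hi ih =>
    intro j hj h
    exact ext_subsingleton_X₃ (σ.shortExact i) (hV i hi j hj (by lia))
      (ih (j + 1) (by lia) (by lia))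

lemma exists_lift_of_ext (k : ℕ) {N : A} (h : Subsingleton (Ext.{w} N (σ.C k) 1))
    (f : N ⟶ σ.V (k + 1)) (hf : f ≫ σ.π (k + 1) ≫ σ.ι (k + 2) = 0) :
    ∃ g, g ≫ σ.π k ≫ σ.ι (k + 1) = f := by
  obtain ⟨f, rfl⟩ := σ.exists_lift (k + 1) f hf
  obtain ⟨g, hg⟩ := exists_lift_of_ext_one (σ.shortExact k) h f
  exact ⟨g, (Category.assoc _ _ _).symm.trans (congrArg (fun z ↦ z ≫ σ.ι (k + 1)) hg)⟩

end Splicing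

/-- Iterated left approximations: since `Ext^j(C k, 𝓜)` vanishes for `1 ≤ j ≤ k`, the syzygy
`C (n - 1)` lies in `𝓜`, and the sequence stops there. -/
lemma IsNClusterTilting.exists_coresolution [HasExt.{w} A] {n : ℕ} {𝓜 : ObjectProperty A}
    (hM : IsNClusterTilting.{w} n 𝓜) (Y : A) :
    ∃ σ : Splicing A, Nonempty (Y ≅ σ.C 0) ∧ (∀ k, 𝓜 (σ.V k)) ∧
      (∀ k N, 𝓜 N → ∀ f : σ.C k ⟶ N, ∃ g, σ.ι k ≫ g = f) ∧
      ∀ k, n ≤ k + 1 → IsIso (σ.ι k) := by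
  choose V j hV hmono hj hiso using hM.exists_mono_approximation
  let C : ℕ → A := Nat.rec (motive := fun _ ↦ A) Y (fun _ X ↦ cokernel (j X))
  let σ : Splicing A :=
    { C := C
      V := fun k ↦ V (C k)
      ι := fun k ↦ j (C k)
      π := fun k ↦ cokernel.π (j (C k))
      zero := fun k ↦ cokernel.condition (j (C k))
      shortExact := fun k ↦ shortExact_cokernel (hmono (C k)) }
  refine ⟨σ, ⟨Iso.refl _⟩, fun k ↦ hV _, fun k ↦ hj _, fun k hk ↦ hiso _ ?_⟩
  have key : ∀ k N, 𝓜 N → ∀ i, 1 ≤ i → i ≤ k → i + 1 ≤ n → Subsingleton (Ext.{w} (σ.C k) N i) := by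
    intro k N hN
    induction k with
    | zero => intro i _ _; lia
    | succ k ih =>
      rintro (_ | _ | i) h₁ h₂ h₃
      · lia
      · exact ext_one_subsingleton_X₃' (σ.shortExact k) (hM.ext_subsingleton (hV _) hN h₁ h₃)
          (hj _ N hN)
      · exact ext_subsingleton_X₃' (σ.shortExact k) (hM.ext_subsingleton (hV _) hN h₁ h₃)
          (ih (i + 1) (by lia) (by lia) (by lia))
  exact (hM.mem_iff_ext_left _).2 fun N hN i h₁ h₂ ↦ key k N hN i h₁ (by lia) (by lia)

end Splicing

/-! ### Torsion classes and `n`-exact sequences -/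

section NTorsion

open scoped ZeroObject

variable {A : Type u} [Category.{v} A] [Abelian A]

/-- The sequence `0 ⟶ ker d ⟶ X₀ ⟶ ker d' ⟶ 0` at a place of exactness of a complex. -/
lemma shortExact_kernel {X₀ X₁ X₂ : A} {d : X₀ ⟶ X₁} {d' : X₁ ⟶ X₂} (w : d ≫ d' = 0)
    (h : Epi (kernel.lift d' d w)) :
    (ShortComplex.mk (kernel.ι d) (kernel.lift d' d w)
      (by simp [← cancel_mono (kernel.ι d')])).ShortExact :=
  .mk' (ShortComplex.exact_of_f_is_kernel _ (KernelFork.IsLimit.ofι' _ _ (fun k hk ↦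
      ⟨kernel.lift d k (by simpa using congrArg (fun z ↦ z ≫ kernel.ι d') hk), by simp⟩)))
    (inferInstanceAs (Mono (kernel.ι d))) h

/-- The same sequence for `d'`, where `ker d'` is identified with `X₀`. -/
lemma shortExact_of_mono {X₀ X₁ X₂ X₃ : A} {d : X₀ ⟶ X₁} {d' : X₁ ⟶ X₂} {d'' : X₂ ⟶ X₃} [Mono d]
    (w : d ≫ d' = 0) (w' : d' ≫ d'' = 0) (h : Epi (kernel.lift d' d w))
    (h' : Epi (kernel.lift d'' d' w')) :
    (ShortComplex.mk d (kernel.lift d'' d' w')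
      (by simp [← cancel_mono (kernel.ι d''), w])).ShortExact := by
  have : Mono (kernel.lift d' d w ≫ kernel.ι d') := by rwa [kernel.lift_ι]
  have := mono_of_mono (kernel.lift d' d w) (kernel.ι d')
  have := isIso_of_mono_of_epi (kernel.lift d' d w)
  refine ShortComplex.shortExact_of_iso (Iso.symm ?_) (shortExact_kernel w' h')
  exact ShortComplex.isoMk (asIso (kernel.lift d' d w)) (Iso.refl _) (Iso.refl _) (by simp)
    (by simp)

namespace IsNExact

variable {n : ℕ} {𝓜 : ObjectProperty A} {K : CochainComplex A ℕ} (hK : IsNExact n 𝓜 K)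
include hK

lemma mono_d (hgen : IsGeneratingSubcategory 𝓜) : Mono (K.d 0 1) := by
  refine Preadditive.mono_of_cancel_zero _ (fun {W} f hf ↦ ?_)
  obtain ⟨N, p, hN, _⟩ := hgen W
  rw [← cancel_epi p, comp_zero]
  exact hK.kernel_zero N hN _ (by simp [hf])

lemma epi_d (hcogen : IsCogeneratingSubcategory 𝓜) : Epi (K.d n (n + 1)) := by
  refine Preadditive.epi_of_cancel_zero _ (fun {W} f hf ↦ ?_)
  obtain ⟨N, j, hN, _⟩ := hcogen W
  rw [← cancel_mono j, zero_comp]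
  exact hK.cokernel_last N hN _ (by simp [reassoc_of% hf])

/-- An `n`-exact sequence in a generating and cogenerating subcategory is exact in the ambient
abelian category. -/
lemma epi_lift (hgen : IsGeneratingSubcategory 𝓜) (hcogen : IsCogeneratingSubcategory 𝓜)
    {i : ℕ} (hi : i ≤ n) :
    Epi (kernel.lift (K.d (i + 1) (i + 2)) (K.d i (i + 1)) (K.d_comp_d _ _ _)) := by
  obtain hi | rfl := hi.lt_or_eq
  · obtain ⟨N, p, hN, _⟩ := hgen (kernel (K.d (i + 1) (i + 2)))
    obtain ⟨g, hg⟩ := hK.kernel_succ N hN i hi (p ≫ kernel.ι _) (by simp)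
    have : g ≫ kernel.lift (K.d (i + 1) (i + 2)) (K.d i (i + 1)) (K.d_comp_d _ _ _) = p := by
      simp [← cancel_mono (kernel.ι _), hg]
    have : Epi (g ≫ kernel.lift (K.d (i + 1) (i + 2)) (K.d i (i + 1)) (K.d_comp_d _ _ _)) := by
      rwa [this]
    exact epi_of_epi g _
  -- At the last place the next differential is zero, and exactness means that `d` is epi.
  · have := hK.epi_d hcogen
    have h0 : K.d (i + 1) (i + 2) = 0 := (hK.isZero (i + 2) (by lia)).eq_of_tgt _ _
    have : IsIso (kernel.ι (K.d (i + 1) (i + 2))) := by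
      rw [h0]
      infer_instance
    have : kernel.lift (K.d (i + 1) (i + 2)) (K.d i (i + 1)) (K.d_comp_d _ _ _) =
        K.d i (i + 1) ≫ inv (kernel.ι (K.d (i + 1) (i + 2))) := by
      simp [← cancel_mono (kernel.ι (K.d (i + 1) (i + 2)))]
    rw [this]
    infer_instance

end IsNExact

variable [HasExt.{w} A] {n : ℕ} {𝓜 𝓤 : ObjectProperty A}

/-- The torsion sequence of an object of `𝓜` for an `n`-torsion class `𝓤`: it is the beginning of
the `n`-exact sequence. For `n ≥ 2`, dimension shifting along the remaining terms identifies
`Ext^{n-1}(U', X₃)` with the cokernel of `Hom(U', Vⁿ⁻¹) ⟶ Hom(U', Vⁿ)`. -/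
lemma IsNTorsionClass.exists_shortExact (hn : 1 ≤ n) (hM : IsNClusterTilting.{w} n 𝓜)
    (hU : IsNTorsionClass n 𝓜 𝓤) {M : A} (h : 𝓜 M) :
    ∃ S : ShortComplex A, S.ShortExact ∧ 𝓤 S.X₁ ∧ Nonempty (S.X₂ ≅ M) ∧
      𝓤.rightOrthogonal S.X₃ ∧ ∀ X, 𝓤 X → Subsingleton (Ext.{w} X S.X₃ (n - 1)) := by
  obtain ⟨K, hK, hK₀, e, hE⟩ := hU.exists_nExact M h
  have hepi {i : ℕ} (hi : i ≤ n) := hK.epi_lift hM.generating hM.cogenerating hi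
  have hSE {i : ℕ} (hi : i ≤ n) := shortExact_kernel (K.d_comp_d i (i + 1) (i + 2)) (hepi hi)
  have := hK.mono_d hM.generating
  have horth : 𝓤.rightOrthogonal (kernel (K.d 2 3)) := fun X f hX ↦ by
    rw [← cancel_mono (kernel.ι _), zero_comp]
    exact (hE X hX).1 _ (by simp)
  refine ⟨_, shortExact_of_mono (K.d_comp_d 0 1 2) (K.d_comp_d 1 2 3) (hepi (Nat.zero_le n))
    (hepi hn), hK₀, e, horth, fun X hX ↦ ?_⟩
  obtain rfl | ⟨m, rfl⟩ : n = 1 ∨ ∃ m, n = m + 2 := by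
    obtain _ | _ | m := n
    · lia
    · simp
    · exact Or.inr ⟨m, rfl⟩
  · refine subsingleton_of_forall_eq 0 fun x ↦ ?_
    obtain ⟨f, rfl⟩ := (Ext.mk₀_bijective X _).2 x
    rw [horth f hX, Ext.mk₀_zero]
  -- Descending induction along the kernels, starting at `ker (Vⁿ⁻¹ ⟶ Vⁿ)`, where the surjectivity
  -- of `Hom(X, Vⁿ⁻¹) ⟶ Hom(X, Vⁿ)` is used.
  · have key : ∀ j k, k + j = m + 2 → 2 ≤ k →
        Subsingleton (Ext.{w} X (kernel (K.d k (k + 1))) (j + 1)) := by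
      intro j
      induction j with
      | zero =>
        rintro k rfl hk
        refine ext_one_subsingleton_X₁ (hSE (i := m + 2) le_rfl)
          (hM.ext_subsingleton (hU.le _ hX) (hK.mem _ (by lia)) le_rfl (by lia)) (fun f ↦ ?_)
        obtain ⟨g, hg⟩ := (hE X hX).2 (m + 2) (by lia) le_rfl (f ≫ kernel.ι _) (by simp)
        exact ⟨g, by simp [← cancel_mono (kernel.ι _), hg]⟩
      | succ j ih =>
        intro k hk hk₂
        exact ext_subsingleton_X₁ (hSE (i := k) (by lia))
          (hM.ext_subsingleton (hU.le _ hX) (hK.mem _ (by lia)) (by lia) (by lia))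
          (ih (k + 1) (by lia) (by lia))
    exact key m 2 (by lia) le_rfl

/-- The converse construction: a short exact sequence `0 ⟶ U ⟶ M ⟶ F ⟶ 0` with `U` in `𝓤`, `F` in
`𝓤^⊥` and `Ext^{n-1}(𝓤, F) = 0` is completed to the required `n`-exact sequence by coresolving `F`.
The `Ext^j(𝓤, F)` with `1 ≤ j < n - 1` vanish because they embed into `Ext^{j+1}(𝓤, U)`. -/
lemma IsNClusterTilting.exists_nExact (hn : 1 ≤ n) (hM : IsNClusterTilting.{w} n 𝓜)
    (hle : 𝓤 ≤ 𝓜) {S : ShortComplex A} (hS : S.ShortExact) (h₁ : 𝓤 S.X₁) (h₂ : 𝓜 S.X₂)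
    (h₃ : 𝓤.rightOrthogonal S.X₃)
    (hext : ∀ X, 𝓤 X → Subsingleton (Ext.{w} X S.X₃ (n - 1))) :
    ∃ K : CochainComplex A ℕ,
      IsNExact n 𝓜 K ∧ 𝓤 (K.X 0) ∧ Nonempty (K.X 1 ≅ S.X₂) ∧
      ∀ U' : A, 𝓤 U' →
        (∀ f : U' ⟶ K.X 2, f ≫ K.d 2 3 = 0 → f = 0) ∧
        (∀ i, 2 ≤ i → i ≤ n → ∀ f : U' ⟶ K.X (i + 1), f ≫ K.d (i + 1) (i + 2) = 0 →
          ∃ g : U' ⟶ K.X i, g ≫ K.d i (i + 1) = f) := by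
  -- `τ` is the coresolution of `S.X₃` preceded by `0 ⟶ S.X₁ ⟶ S.X₁` and `S`; its syzygies are `0`,
  -- `S.X₁`, and those of `S.X₃`.
  obtain ⟨σ, ⟨e⟩, hσV, hσι, hσiso⟩ := hM.exists_coresolution S.X₃
  have hid : (ShortComplex.mk (0 : (0 : A) ⟶ S.X₁) (𝟙 S.X₁) zero_comp).ShortExact :=
    .mk' ((ShortComplex.exact_iff_mono _ rfl).2 (inferInstanceAs (Mono (𝟙 S.X₁))))
      ((isZero_zero A).mono _) (inferInstanceAs (Epi (𝟙 S.X₁)))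
  let τ : Splicing A := (σ.cons S hS e).cons _ hid (Iso.refl _)
  have hτV : ∀ k, 𝓜 (τ.V k)
    | 0 => hle _ h₁
    | 1 => h₂
    | k + 2 => hσV k
  have hτ₀ : IsZero (τ.C 0) := isZero_zero A
  have hτC₂ : 𝓤.rightOrthogonal (τ.C 2) := 𝓤.rightOrthogonal.prop_of_iso e h₃
  have hτιso : ∀ k, n + 1 ≤ k → 2 ≤ k → IsIso (τ.ι k)
    | 0, _, h => by lia
    | 1, _, h => by lia
    | k + 2, h, _ => hσiso k (by lia)
  have hτzero (k : ℕ) (hk : n + 1 < k) : IsZero (τ.V k) := by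
    obtain _ | k := k
    · lia
    have := hτιso k (by lia) (by lia)
    have := hτιso (k + 1) (by lia) (by lia)
    exact (τ.isZero_C_succ k).of_iso (asIso (τ.ι (k + 1))).symm
  have hτext {N : A} (hN : 𝓜 N) : ∀ i, 0 ≤ i → ∀ j, 1 ≤ j → j + i ≤ n →
      Subsingleton (Ext.{w} N (τ.C i) j) :=
    τ.ext_C_subsingleton 0 n (fun j _ _ ↦ ext_subsingleton_of_isZero hτ₀ j)
      (fun i _ j hj h ↦ hM.ext_subsingleton hN (hτV i) hj (by lia))
  -- `hext` enters for `j = n - 1`; smaller degrees are covered by `hτext`.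
  have hτext' {N : A} (hN : 𝓤 N) : ∀ i, 2 ≤ i → ∀ j, 1 ≤ j → j + i ≤ n + 1 →
      Subsingleton (Ext.{w} N (τ.C i) j) := by
    refine τ.ext_C_subsingleton 2 (n + 1) (fun j hj h ↦ ?_)
      (fun i hi j hj h ↦ hM.ext_subsingleton (hle _ hN) (hτV i) hj (by lia))
    obtain h | h : j + 2 ≤ n ∨ j = n - 1 := by lia
    · exact hτext (hle _ hN) 2 (by lia) j hj h
    · exact h ▸ ext_subsingleton_of_iso (Iso.refl N) e (hext N hN)
  refine ⟨τ.complex, ⟨fun i _ ↦ hτV i, fun i hi ↦ hτzero i hi, ?_, ?_, ?_, ?_⟩, h₁,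
    ⟨Iso.refl _⟩, fun U' hU' ↦ ⟨?_, ?_⟩⟩
  · intro N _ f hf
    obtain ⟨g, rfl⟩ := τ.exists_lift 0 f ((τ.comp_complex_d 0 f).symm.trans hf)
    rw [hτ₀.eq_of_tgt g 0]
    exact zero_comp
  · intro N hN i hi f hf
    obtain ⟨g, hg⟩ := τ.exists_lift_of_ext i (hτext hN i (by lia) 1 le_rfl (by lia)) f
      ((τ.comp_complex_d (i + 1) f).symm.trans hf)
    exact ⟨g, (τ.comp_complex_d i g).trans hg⟩
  · intro N _ f hf
    have := hτιso (n + 1) le_rfl (by lia)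
    exact zero_of_epi_comp (τ.ι (n + 1))
      (zero_of_epi_comp (τ.π n) ((τ.complex_d_comp n f).symm.trans hf))
  · intro N hN i _ f hf
    obtain ⟨g, hg⟩ := τ.exists_desc (i + 1) f
      (zero_of_epi_comp (τ.π i) ((τ.complex_d_comp i f).symm.trans hf))
    obtain ⟨g', rfl⟩ := hσι i N hN g
    exact ⟨g', (τ.complex_d_comp (i + 1) g').trans hg⟩
  · intro f hf
    obtain ⟨g, rfl⟩ := τ.exists_lift 2 f ((τ.comp_complex_d 2 f).symm.trans hf)
    rw [hτC₂ g hU']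
    exact zero_comp
  · intro i hi hi' f hf
    obtain ⟨g, hg⟩ := τ.exists_lift_of_ext i (hτext' hU' i hi 1 le_rfl (by lia)) f
      ((τ.comp_complex_d (i + 1) f).symm.trans hf)
    exact ⟨g, (τ.comp_complex_d i g).trans hg⟩

end NTorsion

/-! ### Torsion parts -/

section TorsionParts

variable {A : Type u} [Category.{v} A] [Abelian A] {𝒯 𝓕 𝓜 : ObjectProperty A}

lemma torsionParts_isClosedUnderIsomorphisms :
    (torsionParts 𝒯 𝓕 𝓜).IsClosedUnderIsomorphisms where
  of_iso e := by
    rintro ⟨S, hS, h₁, h₂, h₃, ⟨e'⟩⟩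
    exact ⟨S, hS, h₁, h₂, h₃, ⟨e.symm ≪≫ e'⟩⟩

namespace IsTorsionPair

variable (h : IsTorsionPair 𝒯 𝓕)
include h

lemma torsionParts_le : torsionParts 𝒯 𝓕 𝓜 ≤ 𝒯 := by
  rintro X ⟨S, _, h₁, _, _, ⟨e⟩⟩
  have := h.closedUnderIso_left
  exact 𝒯.prop_of_iso e.symm h₁

lemma inf_le_torsionParts [𝓜.IsClosedUnderIsomorphisms] : 𝒯 ⊓ 𝓜 ≤ torsionParts 𝒯 𝓕 𝓜 := by
  rintro X ⟨hX, hX'⟩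
  obtain ⟨S, hS, h₁, ⟨e⟩, h₃⟩ := h.exists_shortExact X
  have := h.closedUnderIso_left
  have := hS.isIso_f_of_g_eq_zero (h.hom_eq_zero _ _ (𝒯.prop_of_iso e.symm hX) h₃ S.g)
  exact ⟨S, hS, h₁, 𝓜.prop_of_iso e.symm hX', h₃, ⟨e.symm ≪≫ (asIso S.f).symm⟩⟩

end IsTorsionPair

variable [HasExt.{w} A] {n : ℕ} {𝓤 : ObjectProperty A}

/-- The canonical sequence of an object of `𝓜` for the torsion pair generated by an `n`-torsion
class `𝓤` is the sequence coming from `𝓤`. -/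
lemma IsNTorsionClass.mem_of_shortExact (hA : IsLengthCategory A) (hn : 1 ≤ n)
    (hM : IsNClusterTilting.{w} n 𝓜) (hU : IsNTorsionClass n 𝓜 𝓤)
    (h : IsTorsionPair (minTorsionClass 𝓤) 𝓕) {S : ShortComplex A} (hS : S.ShortExact)
    (h₁ : minTorsionClass 𝓤 S.X₁) (h₂ : 𝓜 S.X₂) (h₃ : 𝓕 S.X₃) :
    𝓤 S.X₁ ∧ ∀ X, 𝓤 X → Subsingleton (Ext.{w} X S.X₃ (n - 1)) := by
  obtain ⟨S', hS', h₁', ⟨e⟩, h₃', hext⟩ := hU.exists_shortExact hn hM h₂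
  rw [minTorsionClass_eq hA] at h₁
  obtain ⟨⟨e₁⟩, ⟨e₃⟩⟩ := exists_iso_of_shortExact hS' hS e
    (h.hom_eq_zero _ _ (le_minTorsionClass _ _ h₁') h₃) (fun f ↦ h₁ f h₃')
  have := hU.closedUnderIso
  exact ⟨𝓤.prop_of_iso e₁ h₁', fun X hX ↦ ext_subsingleton_of_iso (Iso.refl X) e₃ (hext X hX)⟩

theorem IsNTorsionClass.torsionParts_eq (hA : IsLengthCategory A) (hn : 1 ≤ n)
    (hM : IsNClusterTilting.{w} n 𝓜) (hU : IsNTorsionClass n 𝓜 𝓤)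
    (h : IsTorsionPair (minTorsionClass 𝓤) 𝓕) :
    torsionParts (minTorsionClass 𝓤) 𝓕 𝓜 = 𝓤 := by
  have := hM.isClosedUnderIsomorphisms
  have := hU.closedUnderIso
  refine le_antisymm ?_ (le_trans ?_ h.inf_le_torsionParts)
  · rintro X ⟨S, hS, h₁, h₂, h₃, ⟨e⟩⟩
    exact 𝓤.prop_of_iso e.symm (hU.mem_of_shortExact hA hn hM h hS h₁ h₂ h₃).1
  · exact le_inf (le_minTorsionClass 𝓤) hU.le

/-- The torsion parts form an `n`-torsion class as soon as they lie in `𝓜` and the `Ext`-condition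
holds; that they generate `𝒯` is not needed for this. -/
theorem isNTorsionClass_torsionParts (hn : 1 ≤ n) (hM : IsNClusterTilting.{w} n 𝓜)
    (h : IsTorsionPair 𝒯 𝓕) (hle : torsionParts 𝒯 𝓕 𝓜 ≤ 𝓜)
    (hext : ∀ X Y : A, torsionParts 𝒯 𝓕 𝓜 X → torsionFreeParts 𝒯 𝓕 𝓜 Y →
      Subsingleton (Ext.{w} X Y (n - 1))) :
    IsNTorsionClass n 𝓜 (torsionParts 𝒯 𝓕 𝓜) where
  closedUnderIso := torsionParts_isClosedUnderIsomorphisms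
  le := hle
  exists_nExact M hMM := by
    obtain ⟨S, hS, h₁, ⟨e⟩, h₃⟩ := h.exists_shortExact M
    have := hM.isClosedUnderIsomorphisms
    have h₂ : 𝓜 S.X₂ := 𝓜.prop_of_iso e.symm hMM
    obtain ⟨K, hK, hK₀, ⟨e'⟩, hK'⟩ := hM.exists_nExact hn hle hS
      ⟨S, hS, h₁, h₂, h₃, ⟨Iso.refl _⟩⟩ h₂
      (fun X f hX ↦ h.hom_eq_zero X _ (h.torsionParts_le X hX) h₃ f)
      (fun X hX ↦ hext X _ hX ⟨S, hS, h₁, h₂, h₃, ⟨Iso.refl _⟩⟩)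
    exact ⟨K, hK, hK₀, ⟨e' ≪≫ e⟩, hK'⟩

end TorsionParts

end NTors

theorem mainTheorem1 {A : Type u} [Category.{v} A] [Abelian A] [EssentiallySmall.{v} A]
    [HasExt.{w} A] (hA : NTors.IsLengthCategory A) (n : ℕ) (hn : 1 ≤ n)
    (𝓜 : ObjectProperty A) (hM : NTors.IsNClusterTilting.{w} n 𝓜) :
    -- `𝓤 ↦ T(𝓤)` is an injective morphism of posets from `n`-torsion classes to torsion classes
    ((∀ 𝓤 : ObjectProperty A, NTors.IsNTorsionClass n 𝓜 𝓤 →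
        NTors.IsTorsionClass (NTors.minTorsionClass 𝓤)) ∧
      (∀ 𝓤₁ 𝓤₂ : ObjectProperty A,
        NTors.IsNTorsionClass n 𝓜 𝓤₁ → NTors.IsNTorsionClass n 𝓜 𝓤₂ →
          (𝓤₁ ≤ 𝓤₂ → NTors.minTorsionClass 𝓤₁ ≤ NTors.minTorsionClass 𝓤₂) ∧
          (NTors.minTorsionClass 𝓤₁ = NTors.minTorsionClass 𝓤₂ → 𝓤₁ = 𝓤₂))) ∧
    -- characterisation of the torsion classes of the form `T(𝓤)`
    ∀ 𝒯 𝓕 : ObjectProperty A, NTors.IsTorsionPair 𝒯 𝓕 →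
      ((∃ 𝓤 : ObjectProperty A, NTors.IsNTorsionClass n 𝓜 𝓤 ∧ 𝒯 = NTors.minTorsionClass 𝓤) ↔
        (NTors.torsionParts 𝒯 𝓕 𝓜 ≤ 𝓜 ∧
          𝒯 = NTors.minTorsionClass (NTors.torsionParts 𝒯 𝓕 𝓜) ∧
          ∀ X Y : A, NTors.torsionParts 𝒯 𝓕 𝓜 X → NTors.torsionFreeParts 𝒯 𝓕 𝓜 Y →
            Subsingleton (Ext.{w} X Y (n - 1)))) ∧
      ∀ 𝓤 : ObjectProperty A, NTors.IsNTorsionClass n 𝓜 𝓤 → 𝒯 = NTors.minTorsionClass 𝓤 →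
        𝓤 = 𝒯 ⊓ 𝓜 ∧ 𝓤 = NTors.torsionParts 𝒯 𝓕 𝓜 := by
  refine ⟨⟨fun 𝓤 _ ↦ ?_, fun 𝓤₁ 𝓤₂ h₁ h₂ ↦ ⟨NTors.minTorsionClass_mono, fun h ↦ ?_⟩⟩,
    fun 𝒯 𝓕 h ↦ ⟨⟨?_, ?_⟩, ?_⟩⟩
  · rw [NTors.minTorsionClass_eq hA]
    exact ⟨_, NTors.isTorsionPair_leftOrthogonal_rightOrthogonal hA 𝓤⟩
  · have hT := NTors.isTorsionPair_leftOrthogonal_rightOrthogonal hA 𝓤₁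
    rw [← NTors.minTorsionClass_eq hA] at hT
    rw [← h₁.torsionParts_eq hA hn hM hT, ← h₂.torsionParts_eq hA hn hM (h ▸ hT), h]
  · rintro ⟨𝓤, hU, rfl⟩
    have hparts := hU.torsionParts_eq hA hn hM h
    refine ⟨hparts.le.trans hU.le, by rw [hparts], ?_⟩
    rintro X Y hX ⟨S, hS, h₁, h₂, h₃, ⟨e⟩⟩
    exact NTors.ext_subsingleton_of_iso (Iso.refl X) e.symm
      ((hU.mem_of_shortExact hA hn hM h hS h₁ h₂ h₃).2 X (hparts.le X hX))
  · rintro ⟨hle, hT, hext⟩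
    exact ⟨_, NTors.isNTorsionClass_torsionParts hn hM h hle hext, hT⟩
  · rintro 𝓤 hU rfl
    have := hM.isClosedUnderIsomorphisms
    have hparts := hU.torsionParts_eq hA hn hM h
    exact ⟨le_antisymm (le_inf (NTors.le_minTorsionClass 𝓤) hU.le)
      (h.inf_le_torsionParts.trans hparts.le), hparts.symm⟩
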